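/- Let $N\ge 2$ be an integer, $s\in(0,1)$ and $p\in(1,\infty)$. Let $W^{s,p}(\mathbb R^N)$ be the space of all $u\in L^p(\mathbb R^N)$ with $$\int_{\mathbb R^N\times\mathbb R^N}\frac{|u(x)-u(y)|^p}{|x-y|^{N+ps}}\,dx\,dy<\infty ,$$ and, for an open set $\Omega\subset\mathbb R^N$, let $W^{s,p}_0(\Omega)$ be the set of all $u\in W^{s,p}(\mathbb R^N)$ with $u=0$ a.e. in $\mathbb R^N\setminus\Omega$. For $u\in W_0^{s,p}(\Omega)$ and $K\ge 0$ we say that $|(-\Delta)^s_p u|\le K$ weakly in $\Omega$ if, for all $\varphi\in W_0^{s,p}(\Omega)$ with $\varphi\ge 0$ a.e. in $\Omega$, $$-K\int_\Omega\varphi\,dx\;\le\;\int_{\mathbb R^N\times\mathbb R^N}\frac{|u(x)-u(y)|^{p-2}(u(x)-u(y))(\varphi(x)-\varphi(y))}{|x-y|^{N+ps}}\,dx\,dy\;\le\;K\int_\Omega\varphi\,dx .$$ **Theorem 4.1 (a priori bound).** For every $d$ there is a constant $C_d>0$, depending only on $N$, $s$, $p$ and $d$, such that the following holds. Let $\Omega\subset\mathbb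 R^N$ be a bounded open set with $\operatorname{diam}(\Omega)=d$, let $K\ge 0$, and let $u\in W^{s,p}_0(\Omega)$ satisfy $|(-\Delta)^s_p u|\le K$ weakly in $\Omega$. Then $$\|u\|_{L^\infty(\Omega)}\le (C_dK)^{\frac1{p-1}} .$$ (In particular this applies to every bounded domain with $C^{1,1}$ boundary.) -/

import Mathlib

open MeasureTheory
open scoped ENNReal

namespace FracPLap

noncomputable section

/-- The power of the Gagliardo seminorm of `u` on `U`:
`∫_{U × U} |u x - u y| ^ p / |x - y| ^ (N + p s) dx dy`, with values in `[0, ∞]`. -/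
def gagliardo {N : ℕ} (s p : ℝ) (U : Set (EuclideanSpace ℝ (Fin N)))
    (u : EuclideanSpace ℝ (Fin N) → ℝ) : ℝ≥0∞ :=
  ∫⁻ z : EuclideanSpace ℝ (Fin N) × EuclideanSpace ℝ (Fin N),
    ENNReal.ofReal (|u z.1 - u z.2| ^ p / ‖z.1 - z.2‖ ^ ((N : ℝ) + p * s))
    ∂((volume.restrict U).prod (volume.restrict U))

/-- Membership in the fractional Sobolev space `W^{s,p}(U)`. -/
def MemW {N : ℕ} (s p : ℝ) (U : Set (EuclideanSpace ℝ (Fin N)))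
    (u : EuclideanSpace ℝ (Fin N) → ℝ) : Prop :=
  MemLp u (ENNReal.ofReal p) (volume.restrict U) ∧ gagliardo s p U u < ∞

/-- Membership in `W_0^{s,p}(U)`: functions in `W^{s,p}(ℝ^N)` that vanish a.e. in the
complement of `U`. -/
def MemW0 {N : ℕ} (s p : ℝ) (U : Set (EuclideanSpace ℝ (Fin N)))
    (u : EuclideanSpace ℝ (Fin N) → ℝ) : Prop :=
  MemW s p Set.univ u ∧ ∀ᵐ x ∂(volume : Measure (EuclideanSpace ℝ (Fin N))), x ∉ U → u x = 0

/-- The signed power `a ^ (p - 1) = |a| ^ (p - 2) * a`. -/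
def signedPow (p a : ℝ) : ℝ := |a| ^ (p - 2) * a

/-- The weak form of the `s`-fractional `p`-Laplacian on `ℝ^N`:
`∫_{ℝ^N × ℝ^N} (u x - u y)^(p-1) (φ x - φ y) / |x - y| ^ (N + p s) dx dy`.
For `u` and `φ` in `W^{s,p}(ℝ^N)` the integrand is integrable by Hölder's inequality. -/
def weakForm {N : ℕ} (s p : ℝ) (u φ : EuclideanSpace ℝ (Fin N) → ℝ) : ℝ :=
  ∫ z : EuclideanSpace ℝ (Fin N) × EuclideanSpace ℝ (Fin N),
    signedPow p (u z.1 - u z.2) * (φ z.1 - φ z.2) / ‖z.1 - z.2‖ ^ ((N : ℝ) + p * s)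

/-- `(-Δ)_p^s u ≤ K` weakly in `U`, for `u` in `W_0^{s,p}(U)`: the inequality is tested with all
nonnegative functions in `W_0^{s,p}(U)`. -/
def WeakLE {N : ℕ} (s p : ℝ) (U : Set (EuclideanSpace ℝ (Fin N)))
    (u : EuclideanSpace ℝ (Fin N) → ℝ) (K : ℝ) : Prop :=
  ∀ φ : EuclideanSpace ℝ (Fin N) → ℝ, MemW0 s p U φ →
    (∀ᵐ x ∂(volume.restrict U), 0 ≤ φ x) → weakForm s p u φ ≤ ∫ x in U, K * φ x

/-- `(-Δ)_p^s u ≥ K` weakly in `U`, for `u` in `W_0^{s,p}(U)`. -/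
def WeakGE {N : ℕ} (s p : ℝ) (U : Set (EuclideanSpace ℝ (Fin N)))
    (u : EuclideanSpace ℝ (Fin N) → ℝ) (K : ℝ) : Prop :=
  ∀ φ : EuclideanSpace ℝ (Fin N) → ℝ, MemW0 s p U φ →
    (∀ᵐ x ∂(volume.restrict U), 0 ≤ φ x) → ∫ x in U, K * φ x ≤ weakForm s p u φ

/-- `|(-Δ)_p^s u| ≤ K` weakly in `U`, for `u` in `W_0^{s,p}(U)`. -/
def WeakAbsLE {N : ℕ} (s p : ℝ) (U : Set (EuclideanSpace ℝ (Fin N)))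
    (u : EuclideanSpace ℝ (Fin N) → ℝ) (K : ℝ) : Prop :=
  WeakLE s p U u K ∧ WeakGE s p U u (-K)

end

end FracPLap

namespace FracPLap

/-! This is De Giorgi–Stampacchia truncation. The increments of `(u - k)₊` are no larger than those
of `u` and never of opposite sign, so testing with `(u - k)₊` bounds its Gagliardo energy by `K ∫ (u
- k)₊` (`gagliardo_le_ofReal_weakForm`). A fractional Faber–Krahn inequality
(`lintegral_rpow_le_gagliardo`), proved directly and so without any relation between `p * s` and
`N`, combines with Hölder on the superlevel set and Markov into a decay estimate
(`WeakLE.superlevel_decay`). The power there exceeds one, which forces the superlevel sets to be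
null from a finite height on (`stampacchia`).

That height depends on `Ω` only through a bound on its volume, hence on the diameter. The lower
bound is the upper bound for `-u`. -/

/-! ### Pointwise inequalities for the signed power -/

lemma signedPow_mul_eq {p a b : ℝ} (hp : 1 < p) (h : 0 ≤ a * b) :
    signedPow p a * b = |a| ^ (p - 1) * |b| := by
  rcases eq_or_ne a 0 with rfl | ha
  · simp [signedPow, Real.zero_rpow (show p - 1 ≠ 0 by linarith)]
  · have ha' : 0 < |a| := abs_pos.mpr ha
    have : p - 1 = p - 2 + 1 := by ring
    rw [signedPow, this, Real.rpow_add_one ha'.ne', mul_assoc, mul_assoc, ← abs_mul, abs_of_nonneg h]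

lemma rpow_abs_eq {p a : ℝ} (hp : 1 < p) : |a| ^ p = |a| ^ (p - 1) * |a| := by
  rcases eq_or_ne a 0 with rfl | ha
  · simp [Real.zero_rpow (show p ≠ 0 by linarith)]
  · rw [← Real.rpow_add_one (abs_pos.mpr ha).ne']; congr 1; ring

lemma rpow_abs_le_signedPow_mul {p a b : ℝ} (hp : 1 < p) (hab : |b| ≤ |a|) (h : 0 ≤ a * b) :
    |b| ^ p ≤ signedPow p a * b := by
  rw [signedPow_mul_eq hp h, rpow_abs_eq hp]
  have : |b| ^ (p - 1) ≤ |a| ^ (p - 1) :=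
    Real.rpow_le_rpow (abs_nonneg _) hab (by linarith)
  gcongr

lemma signedPow_mul_le {p a b : ℝ} (hp : 1 < p) (hab : |b| ≤ |a|) (h : 0 ≤ a * b) :
    signedPow p a * b ≤ |a| ^ p := by
  rw [signedPow_mul_eq hp h, rpow_abs_eq hp]
  gcongr

lemma signedPow_neg (p a : ℝ) : signedPow p (-a) = -signedPow p a := by
  simp [signedPow]

/-! ### Energy of a truncation -/

variable {N : ℕ}

lemma gagliardo_univ (s p : ℝ) (u : EuclideanSpace ℝ (Fin N) → ℝ) :
    gagliardo s p Set.univ u = ∫⁻ z : EuclideanSpace ℝ (Fin N) × EuclideanSpace ℝ (Fin N),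
      ENNReal.ofReal (|u z.1 - u z.2| ^ p / ‖z.1 - z.2‖ ^ ((N : ℝ) + p * s)) := by
  simp [gagliardo, Measure.volume_eq_prod]

lemma gagliardo_mono {s p : ℝ} (hp : 0 ≤ p) {U : Set (EuclideanSpace ℝ (Fin N))}
    {u v : EuclideanSpace ℝ (Fin N) → ℝ} (h : ∀ x y, |v x - v y| ≤ |u x - u y|) :
    gagliardo s p U v ≤ gagliardo s p U u := by
  refine lintegral_mono fun z => ENNReal.ofReal_le_ofReal ?_
  have := h z.1 z.2
  gcongr

lemma gagliardo_le_ofReal_weakForm {s p : ℝ} (hp : 1 < p)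
    {u G : EuclideanSpace ℝ (Fin N) → ℝ} (hu : Measurable u) (hG : Measurable G)
    (hle : ∀ x y, |G x - G y| ≤ |u x - u y|) (hnn : ∀ x y, 0 ≤ (u x - u y) * (G x - G y))
    (hfin : gagliardo s p Set.univ u < ∞) :
    gagliardo s p Set.univ G ≤ ENNReal.ofReal (weakForm s p u G) := by
  have hpos : ∀ z : EuclideanSpace ℝ (Fin N) × EuclideanSpace ℝ (Fin N),
      0 ≤ signedPow p (u z.1 - u z.2) * (G z.1 - G z.2) / ‖z.1 - z.2‖ ^ ((N : ℝ) + p * s) := by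
    intro z
    refine div_nonneg ?_ (by positivity)
    rw [signedPow_mul_eq hp (hnn _ _)]
    positivity
  have hmeas : Measurable fun z : EuclideanSpace ℝ (Fin N) × EuclideanSpace ℝ (Fin N) =>
      signedPow p (u z.1 - u z.2) * (G z.1 - G z.2) / ‖z.1 - z.2‖ ^ ((N : ℝ) + p * s) := by
    unfold signedPow
    simp only [← Real.norm_eq_abs]
    fun_prop
  rw [gagliardo_univ] at hfin ⊢
  -- Integrability matters: otherwise the Bochner integral in `weakForm` is 0 by default and bounds
  -- nothing.
  have hint : Integrable fun z : EuclideanSpace ℝ (Fin N) × EuclideanSpace ℝ (Fin N) =>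
      signedPow p (u z.1 - u z.2) * (G z.1 - G z.2) / ‖z.1 - z.2‖ ^ ((N : ℝ) + p * s) := by
    refine ⟨hmeas.aestronglyMeasurable, ?_⟩
    rw [hasFiniteIntegral_iff_ofReal (ae_of_all _ hpos)]
    refine (lintegral_mono fun z => ENNReal.ofReal_le_ofReal ?_).trans_lt hfin
    gcongr
    exact signedPow_mul_le hp (hle _ _) (hnn _ _)
  rw [weakForm, ofReal_integral_eq_lintegral_ofReal hint (ae_of_all _ hpos)]
  refine lintegral_mono fun z => ENNReal.ofReal_le_ofReal ?_
  gcongr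
  exact rpow_abs_le_signedPow_mul hp (hle _ _) (hnn _ _)

/-! ### Fractional Faber–Krahn inequality and Hölder -/

/-- The volume of the unit ball, as a real number. -/
noncomputable def unitVol (N : ℕ) : ℝ :=
  (volume (Metric.ball (0 : EuclideanSpace ℝ (Fin N)) 1)).toReal

lemma unitVol_pos (N : ℕ) : 0 < unitVol N :=
  ENNReal.toReal_pos (Metric.measure_ball_pos _ _ one_pos).ne' measure_ball_lt_top.ne

lemma volume_ball_eq_unitVol (x : EuclideanSpace ℝ (Fin N)) {r : ℝ} (hr : 0 < r) :
    volume (Metric.ball x r) = ENNReal.ofReal (r ^ N * unitVol N) := by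
  rw [Measure.addHaar_ball_of_pos _ _ hr, unitVol, ENNReal.ofReal_mul (by positivity),
    ENNReal.ofReal_toReal measure_ball_lt_top.ne]
  simp

/-- A Faber–Krahn type inequality for the Gagliardo seminorm. -/
lemma lintegral_rpow_le_gagliardo (hN : 0 < N) {s p : ℝ} (hs : 0 < s) (hp : 0 < p)
    {G : EuclideanSpace ℝ (Fin N) → ℝ} (hG : Measurable G) (hG0 : ∀ x, 0 ≤ G x)
    {a : ℝ} (ha : 0 < a) (hA : volume {x | 0 < G x} = ENNReal.ofReal a) :
    ∫⁻ x, ENNReal.ofReal (G x ^ p) ≤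
      ENNReal.ofReal ((2 / unitVol N) ^ (1 + p * s / N) * a ^ (p * s / N)) *
        gagliardo s p Set.univ G := by
  have hv := unitVol_pos N
  have hN' : (0 : ℝ) < N := by exact_mod_cast hN
  set A := {x | 0 < G x} with hAdef
  have hAm : MeasurableSet A := measurableSet_lt measurable_const hG
  -- Balls of radius `R` have volume `2 * a`, so at least `a` of each lies where `G` vanishes; there
  -- the increment of `G` is `G x` itself.
  set R : ℝ := (2 * a / unitVol N) ^ (1 / (N : ℝ)) with hR
  have hRpos : 0 < R := by positivity
  have hRN : R ^ N * unitVol N = 2 * a := by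
    rw [hR, ← Real.rpow_natCast, ← Real.rpow_mul (by positivity), one_div,
      inv_mul_cancel₀ hN'.ne', Real.rpow_one]
    field_simp
  set c : ℝ := a / R ^ ((N : ℝ) + p * s) with hc
  have hcpos : 0 < c := by positivity
  have hcinv : (2 / unitVol N) ^ (1 + p * s / N) * a ^ (p * s / N) * c = 1 := by
    have h1 : R ^ ((N : ℝ) + p * s) = (2 * a / unitVol N) ^ (1 + p * s / N) := by
      rw [hR, ← Real.rpow_mul (by positivity)]
      congr 1
      field_simp
    have h2 : (2 * a / unitVol N) ^ (1 + p * s / N) =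
        (2 / unitVol N) ^ (1 + p * s / N) * (a ^ (p * s / N) * a) := by
      rw [show 2 * a / unitVol N = 2 / unitVol N * a by ring,
        Real.mul_rpow (by positivity) ha.le, add_comm 1 (p * s / N), Real.rpow_add_one ha.ne']
    rw [hc, h1, h2]
    have : 0 < (2 / unitVol N) ^ (1 + p * s / N) := by positivity
    have : 0 < a ^ (p * s / N) := by positivity
    field_simp
  have hball : ∀ x, ENNReal.ofReal a ≤ volume (Metric.ball x R \ A) := by
    intro x
    have h1 : volume (Metric.ball x R) - volume A ≤ volume (Metric.ball x R \ A) :=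
      le_measure_sdiff
    rw [volume_ball_eq_unitVol x hRpos, hRN, hA, ← ENNReal.ofReal_sub _ ha.le] at h1
    convert h1 using 2
    ring
  have key : ∫⁻ x, ENNReal.ofReal (G x ^ p) * ENNReal.ofReal c ≤ gagliardo s p Set.univ G := by
    rw [gagliardo_univ, Measure.volume_eq_prod, lintegral_prod _ (by
      simp only [← Real.norm_eq_abs]
      fun_prop)]
    refine lintegral_mono fun x => ?_
    calc ENNReal.ofReal (G x ^ p) * ENNReal.ofReal c
        = ENNReal.ofReal (G x ^ p / R ^ ((N : ℝ) + p * s)) * ENNReal.ofReal a := by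
          rw [← ENNReal.ofReal_mul (Real.rpow_nonneg (hG0 x) p),
            ← ENNReal.ofReal_mul (div_nonneg (Real.rpow_nonneg (hG0 x) p) (by positivity)), hc]
          congr 1
          ring
      _ ≤ ENNReal.ofReal (G x ^ p / R ^ ((N : ℝ) + p * s)) * volume (Metric.ball x R \ A) := by
          gcongr
          exact hball x
      _ = ∫⁻ _ in Metric.ball x R \ A, ENNReal.ofReal (G x ^ p / R ^ ((N : ℝ) + p * s)) := by
          rw [setLIntegral_const]
      _ ≤ ∫⁻ y in Metric.ball x R \ A,
            ENNReal.ofReal (|G x - G y| ^ p / ‖x - y‖ ^ ((N : ℝ) + p * s)) := by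
          refine setLIntegral_mono' (measurableSet_ball.diff hAm) fun y hy => ?_
          have hGy : G y = 0 := le_antisymm (not_lt.mp hy.2) (hG0 y)
          refine ENNReal.ofReal_le_ofReal ?_
          rw [hGy, sub_zero, abs_of_nonneg (hG0 x)]
          -- On the diagonal the kernel divides by zero, but there `G x = G y = 0`.
          rcases eq_or_ne x y with rfl | hxy
          · rw [hGy, Real.zero_rpow hp.ne']; simp
          · have h0 : 0 < ‖x - y‖ := norm_pos_iff.mpr (sub_ne_zero.mpr hxy)
            have h1 : ‖x - y‖ ≤ R := by
              have := Metric.mem_ball'.mp hy.1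
              rw [dist_eq_norm] at this
              exact this.le
            have := Real.rpow_nonneg (hG0 x) p
            gcongr
      _ ≤ _ := setLIntegral_le_lintegral _ _
  rw [lintegral_mul_const _ (by fun_prop)] at key
  calc ∫⁻ x, ENNReal.ofReal (G x ^ p)
      = ENNReal.ofReal ((2 / unitVol N) ^ (1 + p * s / N) * a ^ (p * s / N)) *
          ((∫⁻ x, ENNReal.ofReal (G x ^ p)) * ENNReal.ofReal c) := by
        rw [mul_comm (∫⁻ x, ENNReal.ofReal (G x ^ p)), ← mul_assoc,
          ← ENNReal.ofReal_mul (by positivity), hcinv, ENNReal.ofReal_one, one_mul]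
    _ ≤ _ := by gcongr

/-- Hölder's inequality for `f` against the indicator of the set where it is positive. -/
lemma lintegral_le_of_support {α : Type*} [MeasurableSpace α] {μ : Measure α} {p : ℝ} (hp : 1 < p)
    {f : α → ℝ≥0∞} (hf : Measurable f) :
    (∫⁻ x, f x ∂μ) ^ p ≤ μ {x | 0 < f x} ^ (p - 1) * ∫⁻ x, f x ^ p ∂μ := by
  have hp0 : 0 < p := by linarith
  set A := {x | 0 < f x}
  have hA : MeasurableSet A := measurableSet_lt measurable_const hf
  have hpq : p.HolderConjugate (p / (p - 1)) := Real.HolderConjugate.conjExponent hp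
  have h := ENNReal.lintegral_mul_le_Lp_mul_Lq μ hpq hf.aemeasurable
    (measurable_const.indicator hA : Measurable (A.indicator fun _ => (1 : ℝ≥0∞))).aemeasurable
  have h1 : ∫⁻ x, (f * A.indicator fun _ => (1 : ℝ≥0∞)) x ∂μ = ∫⁻ x, f x ∂μ := by
    refine lintegral_congr fun x => ?_
    by_cases hx : x ∈ A
    · simp [hx]
    · have : f x = 0 := by simpa [A] using hx
      simp [this]
  have h2 : ∫⁻ x, (A.indicator (fun _ => (1 : ℝ≥0∞)) x) ^ (p / (p - 1)) ∂μ = μ A := by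
    rw [← lintegral_indicator_one hA]
    refine lintegral_congr fun x => ?_
    by_cases hx : x ∈ A
    · simp [hx]
    · simp [hx, hpq.symm.pos]
  rw [h1, h2] at h
  calc (∫⁻ x, f x ∂μ) ^ p
      ≤ ((∫⁻ x, f x ^ p ∂μ) ^ (1 / p) * μ A ^ (1 / (p / (p - 1)))) ^ p := by gcongr
    _ = μ A ^ (p - 1) * ∫⁻ x, f x ^ p ∂μ := by
      rw [ENNReal.mul_rpow_of_nonneg _ _ hp0.le, ← ENNReal.rpow_mul, ← ENNReal.rpow_mul, mul_comm]
      congr 2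
      · field_simp
      · rw [one_div, inv_mul_cancel₀ hp0.ne', ENNReal.rpow_one]

/-! ### Decay of superlevel sets and Stampacchia iteration -/

/-- The constant in the fractional Faber–Krahn inequality. -/
noncomputable def faberKrahnConst (N : ℕ) (s p : ℝ) : ℝ := (2 / unitVol N) ^ (1 + p * s / N)

lemma faberKrahnConst_pos (N : ℕ) (s p : ℝ) : 0 < faberKrahnConst N s p :=
  Real.rpow_pos_of_pos (div_pos two_pos (unitVol_pos N)) _

lemma MemW0.truncate {s p k : ℝ} (hp : 1 < p) (hk : 0 ≤ k)
    {Ω : Set (EuclideanSpace ℝ (Fin N))} {u : EuclideanSpace ℝ (Fin N) → ℝ}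
    (hu : Measurable u) (hW : MemW0 s p Ω u) : MemW0 s p Ω fun x => max (u x - k) 0 := by
  refine ⟨⟨hW.1.1.mono (by fun_prop) (ae_of_all _ fun x => ?_), ?_⟩, ?_⟩
  · rw [Real.norm_of_nonneg (le_max_right _ _), Real.norm_eq_abs]
    exact max_le (by linarith [le_abs_self (u x)]) (abs_nonneg _)
  · refine (gagliardo_mono (by linarith) fun x y => ?_).trans_lt hW.1.2
    simpa using abs_max_sub_max_le_abs (u x - k) (u y - k) 0
  · filter_upwards [hW.2] with x hx hxΩ
    simp [hx hxΩ, hk]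

/-- The decay estimate for the volumes of the superlevel sets of a subsolution. -/
lemma WeakLE.superlevel_decay (hN : 0 < N) {s p : ℝ} (hs : 0 < s) (hp : 1 < p)
    {Ω : Set (EuclideanSpace ℝ (Fin N))} (hΩ : volume Ω ≠ ∞)
    {u : EuclideanSpace ℝ (Fin N) → ℝ} (hu : Measurable u) (hu0 : ∀ x ∉ Ω, u x = 0)
    (hW : MemW0 s p Ω u) {K : ℝ} (hK : 0 ≤ K) (hle : WeakLE s p Ω u K)
    {k h : ℝ} (hk : 0 ≤ k) (hkh : k < h) :
    (h - k) * volume.real {x | h < u x} ≤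
      (faberKrahnConst N s p * K) ^ (1 / (p - 1)) *
        volume.real {x | k < u x} ^ (1 + p * s / N / (p - 1)) := by
  have hp1 : 0 < p - 1 := by linarith
  have hκ := faberKrahnConst_pos N s p
  set a := volume.real {x | k < u x} with ha_def
  have hsub : {x | k < u x} ⊆ Ω := by
    intro x hx
    by_contra hxΩ
    rw [Set.mem_ofPred_eq, hu0 x hxΩ] at hx
    linarith
  have hfin : volume {x | k < u x} ≠ ∞ := measure_ne_top_of_subset hsub hΩ
  have hmono : volume.real {x | h < u x} ≤ a :=
    measureReal_mono (fun x (hx : h < u x) => hkh.trans hx) hfin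
  rcases (measureReal_nonneg : 0 ≤ a).eq_or_lt with ha | ha
  · have : volume.real {x | h < u x} = 0 := le_antisymm (hmono.trans ha.symm.le) measureReal_nonneg
    rw [this, mul_zero]
    have : 0 ≤ volume.real {x | k < u x} := measureReal_nonneg
    positivity
  set G : EuclideanSpace ℝ (Fin N) → ℝ := fun x => max (u x - k) 0 with hG
  have hGm : Measurable G := by fun_prop
  have hG0 : ∀ x, 0 ≤ G x := fun x => le_max_right _ _
  have hGW : MemW0 s p Ω G := hW.truncate hp hk hu
  have hGΩ : ∀ x ∉ Ω, G x = 0 := fun x hx => by simp [hG, hu0 x hx, hk]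
  have hGpos : {x | 0 < G x} = {x | k < u x} := by ext x; simp [hG]
  have hGint : Integrable G := by
    rw [← integrableOn_iff_integrable_of_support_subset (s := Ω)
      (Function.support_subset_iff'.mpr hGΩ)]
    have : IsFiniteMeasure (volume.restrict Ω) := ⟨by simpa using hΩ.lt_top⟩
    have h1 : MemLp G (ENNReal.ofReal p) volume := by simpa using hGW.1.1
    exact h1.restrict Ω |>.integrable (by simpa using hp.le)
  set I := ∫ x, G x with hI
  have hI0 : 0 ≤ I := integral_nonneg hG0
  have hmarkov : (h - k) * volume.real {x | h < u x} ≤ I := by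
    refine le_trans ?_ (mul_meas_ge_le_integral_of_nonneg (ae_of_all _ hG0) hGint (h - k))
    have hsub' : {x | h < u x} ⊆ {x | h - k ≤ G x} := fun x (hx : h < u x) =>
      le_max_of_le_left (sub_le_sub_right hx.le k)
    refine mul_le_mul_of_nonneg_left (measureReal_mono hsub' ?_) (by linarith)
    refine ((measure_mono ?_).trans_lt hΩ.lt_top).ne
    intro x hx
    by_contra hxΩ
    have : h - k ≤ G x := hx
    rw [hGΩ x hxΩ] at this
    linarith
  have hweak : weakForm s p u G ≤ K * I := by
    have := hle G hGW (ae_of_all _ hG0)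
    rwa [integral_const_mul, setIntegral_eq_integral_of_forall_compl_eq_zero hGΩ] at this
  have hgag : gagliardo s p Set.univ G ≤ ENNReal.ofReal (K * I) := by
    refine (gagliardo_le_ofReal_weakForm hp hu hGm ?_ ?_ hW.1.2).trans
      (ENNReal.ofReal_le_ofReal hweak)
    · intro x y
      simpa using abs_max_sub_max_le_abs (u x - k) (u y - k) 0
    · intro x y
      simp only [hG]
      rcases le_total (u x) (u y) with hxy | hxy
      · exact mul_nonneg_of_nonpos_of_nonpos (by linarith)
          (sub_nonpos.mpr (max_le_max_right 0 (by linarith)))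
      · exact mul_nonneg (by linarith) (sub_nonneg.mpr (max_le_max_right 0 (by linarith)))
  have hvol : volume {x | k < u x} = ENNReal.ofReal a := by
    rw [ha_def, measureReal_def, ENNReal.ofReal_toReal hfin]
  have hFK := lintegral_rpow_le_gagliardo hN hs (by linarith : 0 < p) hGm hG0 ha
    (by rw [hGpos, hvol])
  have hHolder := lintegral_le_of_support (μ := volume) hp hGm.ennreal_ofReal
  simp only [ENNReal.ofReal_pos, ENNReal.ofReal_rpow_of_nonneg (hG0 _) (by linarith : 0 ≤ p)]
    at hHolder
  rw [hGpos, hvol, ← ofReal_integral_eq_lintegral_ofReal hGint (ae_of_all _ hG0),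
    ENNReal.ofReal_rpow_of_nonneg hI0 (by linarith),
    ENNReal.ofReal_rpow_of_nonneg ha.le (by linarith)] at hHolder
  have hIp : I ^ p ≤ a ^ (p - 1) * (faberKrahnConst N s p * a ^ (p * s / N) * (K * I)) := by
    rw [← ENNReal.ofReal_le_ofReal_iff (by positivity), ENNReal.ofReal_mul (by positivity),
      ENNReal.ofReal_mul (by positivity)]
    refine hHolder.trans ?_
    gcongr
    exact hFK.trans (by unfold faberKrahnConst; gcongr)
  refine hmarkov.trans ?_
  rcases hI0.eq_or_lt with hI0 | hIpos
  · rw [← hI0]; positivity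
  -- One factor `I` cancels because the energy bound is linear in `I`.
  have hIp' : I ^ (p - 1) ≤ faberKrahnConst N s p * K * a ^ (p - 1 + p * s / N) := by
    have e1 : I ^ p = I ^ (p - 1) * I := by
      rw [← Real.rpow_add_one hIpos.ne']; congr 1; ring
    rw [e1] at hIp
    rw [Real.rpow_add ha]
    refine le_of_mul_le_mul_right (hIp.trans_eq ?_) hIpos
    ring
  calc I = (I ^ (p - 1)) ^ (1 / (p - 1)) := by
        rw [← Real.rpow_mul hIpos.le, mul_one_div_cancel hp1.ne', Real.rpow_one]
    _ ≤ (faberKrahnConst N s p * K * a ^ (p - 1 + p * s / N)) ^ (1 / (p - 1)) := by gcongr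
    _ = _ := by
        rw [Real.mul_rpow (by positivity) (by positivity), ← Real.rpow_mul ha.le]
        congr 2
        field_simp

/-- Stampacchia's lemma. -/
lemma stampacchia {f : ℝ → ℝ} {M δ V D : ℝ} (hf0 : ∀ k, 0 ≤ f k) (hfm : Antitone f)
    (hM : 0 ≤ M) (hδ : 0 < δ) (hV : 0 < V) (hfV : f 0 ≤ V) (hD : 0 < D)
    (hMD : 2 ^ (1 + 1 / δ) * (M * V ^ δ) ≤ D)
    (hdecay : ∀ k h, 0 ≤ k → k < h → (h - k) * f h ≤ M * f k ^ (1 + δ)) : f D = 0 := by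
  -- With `q ^ δ = 1 / 2`, the gain from the superlinear power offsets the halving of the gaps
  -- between the levels `D * (1 - 2⁻ⁿ)`.
  set q : ℝ := 2 ^ (-(1 / δ)) with hq
  have hq0 : 0 < q := by positivity
  have hq1 : q < 1 := Real.rpow_lt_one_of_one_lt_of_neg one_lt_two (by simpa using hδ)
  have hqδ : q ^ δ = 1 / 2 := by
    rw [hq, ← Real.rpow_mul two_pos.le, neg_mul, one_div_mul_cancel hδ.ne', Real.rpow_neg_one]
    norm_num
  have hbound : ∀ n : ℕ, f (D * (1 - (1 / 2) ^ n)) ≤ V * q ^ n := by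
    intro n
    induction n with
    | zero => simpa using hfV
    | succ n ih =>
      have hpow : (1 / 2 : ℝ) ^ n ≤ 1 := pow_le_one₀ (by norm_num) (by norm_num)
      have hpow0 : 0 < (1 / 2 : ℝ) ^ n := by positivity
      have h1 := hdecay (D * (1 - (1 / 2) ^ n)) (D * (1 - (1 / 2) ^ (n + 1)))
        (mul_nonneg hD.le (by linarith)) (mul_lt_mul_of_pos_left (by rw [pow_succ]; linarith) hD)
      have e1 : D * (1 - (1 / 2) ^ (n + 1)) - D * (1 - (1 / 2) ^ n) = D * (1 / 2) ^ n / 2 := by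
        ring
      rw [e1] at h1
      have h2 : f (D * (1 - (1 / 2) ^ n)) ^ (1 + δ) ≤ (V * q ^ n) ^ (1 + δ) :=
        Real.rpow_le_rpow (hf0 _) ih (by linarith)
      have e2 : (V * q ^ n) ^ (1 + δ) = V * q ^ n * (V ^ δ * (1 / 2) ^ n) := by
        rw [Real.rpow_add (by positivity), Real.rpow_one, Real.mul_rpow hV.le (by positivity),
          ← Real.rpow_natCast, ← Real.rpow_mul hq0.le, mul_comm (n : ℝ) δ, Real.rpow_mul hq0.le,
          hqδ, Real.rpow_natCast, Real.rpow_natCast]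
      have e3 : (2 : ℝ) ^ (1 + 1 / δ) = 2 / q := by
        rw [Real.rpow_add two_pos, hq, Real.rpow_neg two_pos.le, Real.rpow_one, div_inv_eq_mul]
      rw [e3] at hMD
      have hMD' : M * V ^ δ ≤ D * q / 2 := by
        rw [div_mul_eq_mul_div, div_le_iff₀ hq0] at hMD
        linarith
      have h3 : D * (1 / 2) ^ n / 2 * f (D * (1 - (1 / 2) ^ (n + 1))) ≤
          D * (1 / 2) ^ n / 2 * (V * q ^ (n + 1)) := by
        calc _ ≤ M * (V * q ^ n * (V ^ δ * (1 / 2) ^ n)) := by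
              rw [← e2]; exact h1.trans (by gcongr)
          _ = M * V ^ δ * (V * q ^ n * (1 / 2) ^ n) := by ring
          _ ≤ D * q / 2 * (V * q ^ n * (1 / 2) ^ n) := by gcongr
          _ = _ := by ring
      exact le_of_mul_le_mul_left h3 (by positivity)
  refine le_antisymm (ge_of_tendsto' (f := fun n : ℕ => V * q ^ n) (x := Filter.atTop) ?_ fun n => ?_)
    (hf0 D)
  · simpa using (tendsto_pow_atTop_nhds_zero_of_lt_one hq0.le hq1).const_mul V
  · refine (hfm ?_).trans (hbound n)
    have : 0 < (1 / 2 : ℝ) ^ n := by positivity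
    nlinarith

/-! ### Invariance under a.e. equality and change of sign -/

lemma weakForm_congr_ae {s p : ℝ} {u v : EuclideanSpace ℝ (Fin N) → ℝ} (h : u =ᵐ[volume] v)
    (φ : EuclideanSpace ℝ (Fin N) → ℝ) : weakForm s p u φ = weakForm s p v φ := by
  refine integral_congr_ae ?_
  rw [Measure.volume_eq_prod]
  filter_upwards [Measure.quasiMeasurePreserving_fst.ae_eq h,
    Measure.quasiMeasurePreserving_snd.ae_eq h] with z h1 h2
  simp only [Function.comp] at h1 h2
  rw [h1, h2]

lemma gagliardo_congr_ae {s p : ℝ} {u v : EuclideanSpace ℝ (Fin N) → ℝ} (h : u =ᵐ[volume] v) :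
    gagliardo s p Set.univ u = gagliardo s p Set.univ v := by
  rw [gagliardo_univ, gagliardo_univ]
  refine lintegral_congr_ae ?_
  rw [Measure.volume_eq_prod]
  filter_upwards [Measure.quasiMeasurePreserving_fst.ae_eq h,
    Measure.quasiMeasurePreserving_snd.ae_eq h] with z h1 h2
  simp only [Function.comp] at h1 h2
  rw [h1, h2]

lemma MemW0.congr_ae {s p : ℝ} {Ω : Set (EuclideanSpace ℝ (Fin N))}
    {u v : EuclideanSpace ℝ (Fin N) → ℝ} (h : u =ᵐ[volume] v) (hu : MemW0 s p Ω u) :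
    MemW0 s p Ω v := by
  refine ⟨⟨hu.1.1.ae_eq (by simpa using h), (gagliardo_congr_ae h) ▸ hu.1.2⟩, ?_⟩
  filter_upwards [h, hu.2] with x hx hx0 hxΩ
  rw [← hx, hx0 hxΩ]

lemma WeakLE.congr_ae {s p K : ℝ} {Ω : Set (EuclideanSpace ℝ (Fin N))}
    {u v : EuclideanSpace ℝ (Fin N) → ℝ} (h : u =ᵐ[volume] v) (hu : WeakLE s p Ω u K) :
    WeakLE s p Ω v K := fun φ hφ hφ0 => weakForm_congr_ae h φ ▸ hu φ hφ hφ0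

lemma weakForm_neg {s p : ℝ} (u φ : EuclideanSpace ℝ (Fin N) → ℝ) :
    weakForm s p (-u) φ = -weakForm s p u φ := by
  rw [weakForm, weakForm, ← integral_neg]
  congr 1 with z
  rw [Pi.neg_apply, Pi.neg_apply, neg_sub_neg, ← neg_sub (u z.1), signedPow_neg]
  ring

lemma MemW0.neg {s p : ℝ} {Ω : Set (EuclideanSpace ℝ (Fin N))}
    {u : EuclideanSpace ℝ (Fin N) → ℝ} (hu : MemW0 s p Ω u) : MemW0 s p Ω (-u) := by
  refine ⟨⟨hu.1.1.neg, ?_⟩, ?_⟩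
  · convert hu.1.2 using 1
    refine lintegral_congr fun z => ?_
    rw [Pi.neg_apply, Pi.neg_apply, neg_sub_neg, abs_sub_comm]
  · filter_upwards [hu.2] with x hx hxΩ
    simp [hx hxΩ]

lemma WeakGE.neg {s p K : ℝ} {Ω : Set (EuclideanSpace ℝ (Fin N))}
    {u : EuclideanSpace ℝ (Fin N) → ℝ} (hu : WeakGE s p Ω u (-K)) : WeakLE s p Ω (-u) K := by
  intro φ hφ hφ0
  have := hu φ hφ hφ0
  simp only [neg_mul, integral_neg] at this
  rw [weakForm_neg]
  linarith

/-! ### The essential bound -/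

/-- Subsolutions are essentially bounded above. -/
lemma WeakLE.ae_le (hN : 0 < N) {s p : ℝ} (hs : 0 < s) (hp : 1 < p)
    {Ω : Set (EuclideanSpace ℝ (Fin N))} (hΩm : MeasurableSet Ω) (hΩ : volume Ω ≠ ∞)
    {u : EuclideanSpace ℝ (Fin N) → ℝ} (hW : MemW0 s p Ω u) {K : ℝ} (hK : 0 ≤ K)
    (hle : WeakLE s p Ω u K) {V D : ℝ} (hV : 0 < V) (hΩV : volume.real Ω ≤ V) (hD : 0 < D)
    (hKD : 2 ^ (1 + 1 / (p * s / N / (p - 1))) *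
      ((faberKrahnConst N s p * K) ^ (1 / (p - 1)) * V ^ (p * s / N / (p - 1))) ≤ D) :
    ∀ᵐ x ∂volume, u x ≤ D := by
  have hp1 : 0 < p - 1 := by linarith
  have hN' : (0 : ℝ) < N := by exact_mod_cast hN
  have hκ := faberKrahnConst_pos N s p
  have hmeas : AEStronglyMeasurable u volume := by simpa using hW.1.1.aestronglyMeasurable
  -- A measurable representative vanishing everywhere off `Ω`, so that its superlevel sets truly lie
  -- in `Ω`.
  set v : EuclideanSpace ℝ (Fin N) → ℝ := Ω.indicator (hmeas.mk u)
  have hvm : Measurable v := hmeas.stronglyMeasurable_mk.measurable.indicator hΩm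
  have hv0 : ∀ x ∉ Ω, v x = 0 := fun x hx => Set.indicator_of_notMem hx _
  have huv : u =ᵐ[volume] v := by
    filter_upwards [hmeas.ae_eq_mk, hW.2] with x hx hx0
    by_cases hxΩ : x ∈ Ω
    · simp [v, hxΩ, hx]
    · rw [hv0 x hxΩ, hx0 hxΩ]
  have hsub : ∀ k, 0 ≤ k → {x | k < v x} ⊆ Ω := by
    intro k hk x (hx : k < v x)
    by_contra hxΩ
    rw [hv0 x hxΩ] at hx
    linarith
  have hzero : volume.real {x | max D 0 < v x} = 0 := by
    -- Levels are cut at 0: for negative `k` the superlevel set has infinite measure, `volume.real`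
    -- returns 0, and monotonicity would fail.
    refine stampacchia (f := fun k => volume.real {x | max k 0 < v x}) (V := V) (D := D)
      (fun _ => measureReal_nonneg)
      (fun k h hkh => measureReal_mono
        (fun x (hx : max h 0 < v x) => (max_le_max_right 0 hkh).trans_lt hx)
        (measure_ne_top_of_subset (hsub _ (le_max_right _ _)) hΩ))
      (by positivity) (by positivity) hV ?_ hD hKD fun k h hk hkh => ?_
    · exact (measureReal_mono (hsub _ (le_max_right _ _)) hΩ).trans hΩV
    · simp only [max_eq_left hk, max_eq_left (hk.trans hkh.le)]
      exact (hle.congr_ae huv).superlevel_decay hN hs hp hΩ hvm hv0 (hW.congr_ae huv) hK hk hkh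
  rw [max_eq_left hD.le, measureReal_eq_zero_iff (measure_ne_top_of_subset (hsub D hD.le) hΩ)]
    at hzero
  have : ∀ᵐ x ∂volume, ¬ D < v x := by rw [ae_iff]; simpa using hzero
  filter_upwards [this, huv] with x hx hxv
  rw [hxv]
  exact not_lt.mp hx

end FracPLap

theorem theorem4p1 (N : ℕ) (hN : 1 < N) (s p : ℝ) (hs0 : 0 < s) (hs1 : s < 1) (hp : 1 < p)
    (d : ℝ) :
    ∃ C : ℝ, 0 < C ∧
      ∀ Ω : Set (EuclideanSpace ℝ (Fin N)), IsOpen Ω → Bornology.IsBounded Ω →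
        Metric.diam Ω = d →
      ∀ (u : EuclideanSpace ℝ (Fin N) → ℝ) (K : ℝ), 0 ≤ K →
        FracPLap.MemW0 s p Ω u → FracPLap.WeakAbsLE s p Ω u K →
        eLpNorm u ∞ (volume.restrict Ω) ≤ ENNReal.ofReal ((C * K) ^ (1 / (p - 1))) := by
  have hp1 : 0 < p - 1 := by linarith
  have hN0 : 0 < N := by omega
  have hN' : (0 : ℝ) < N := by exact_mod_cast hN0
  have hκ := FracPLap.faberKrahnConst_pos N s p
  -- The `+ 1` keeps `V` positive even for `d ≤ 0`.
  set V : ℝ := volume.real (Metric.closedBall (0 : EuclideanSpace ℝ (Fin N)) d) + 1 with hVdef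
  have hV : 0 < V := by
    have : 0 ≤ volume.real (Metric.closedBall (0 : EuclideanSpace ℝ (Fin N)) d) :=
      measureReal_nonneg
    linarith
  set δ : ℝ := p * s / N / (p - 1) with hδ
  have hT : 0 < (2 : ℝ) ^ (1 + 1 / δ) * V ^ δ := by positivity
  refine ⟨FracPLap.faberKrahnConst N s p * (2 ^ (1 + 1 / δ) * V ^ δ) ^ (p - 1), by positivity, ?_⟩
  intro Ω hΩ hΩb hdiam u K hK hW hweak
  have hfin : volume Ω ≠ ∞ := hΩb.measure_lt_top.ne
  have hΩV : volume.real Ω ≤ V := by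
    rcases Ω.eq_empty_or_nonempty with rfl | ⟨x, hx⟩
    · simpa using hV.le
    · have hsub : Ω ⊆ Metric.closedBall x d := fun y hy =>
        Metric.mem_closedBall.mpr (hdiam ▸ Metric.dist_le_diam_of_mem hΩb hy hx)
      refine (measureReal_mono hsub measure_closedBall_lt_top.ne).trans ?_
      rw [measureReal_def, Measure.addHaar_closedBall_center, ← measureReal_def]
      linarith
  have hconst : (FracPLap.faberKrahnConst N s p * (2 ^ (1 + 1 / δ) * V ^ δ) ^ (p - 1) * K) ^
      (1 / (p - 1)) =
      2 ^ (1 + 1 / δ) * ((FracPLap.faberKrahnConst N s p * K) ^ (1 / (p - 1)) * V ^ δ) := by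
    rw [mul_right_comm, Real.mul_rpow (by positivity) (by positivity), ← Real.rpow_mul hT.le,
      mul_one_div_cancel hp1.ne', Real.rpow_one]
    ring
  rw [hconst]
  set D₀ := (2 : ℝ) ^ (1 + 1 / δ) *
    ((FracPLap.faberKrahnConst N s p * K) ^ (1 / (p - 1)) * V ^ δ) with hD₀
  have hD₀nn : 0 ≤ D₀ := by positivity
  -- The iteration needs a positive height, whereas `D₀ = 0` when `K = 0`.
  have hbound : ∀ ε : ℝ, 0 < ε → ∀ᵐ x ∂volume, ‖u x‖ ≤ D₀ + ε := by
    intro ε hε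
    have h1 := hweak.1.ae_le hN0 hs0 hp hΩ.measurableSet hfin hW hK hV hΩV
      (D := D₀ + ε) (by linarith) (by rw [← hδ, ← hD₀]; linarith)
    have h2 := hweak.2.neg.ae_le hN0 hs0 hp hΩ.measurableSet hfin hW.neg hK hV hΩV
      (D := D₀ + ε) (by linarith) (by rw [← hδ, ← hD₀]; linarith)
    filter_upwards [h1, h2] with x h1 h2
    rw [Pi.neg_apply] at h2
    exact abs_le.mpr ⟨by linarith, h1⟩
  have hae : ∀ᵐ x ∂volume, ‖u x‖ ≤ D₀ := by
    have : ∀ᵐ x ∂volume, ∀ n : ℕ, ‖u x‖ ≤ D₀ + 1 / ((n : ℝ) + 1) :=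
      ae_all_iff.mpr fun n => hbound _ Nat.one_div_pos_of_nat
    filter_upwards [this] with x hx
    refine le_of_forall_pos_le_add fun ε hε => ?_
    obtain ⟨n, hn⟩ := exists_nat_one_div_lt hε
    exact (hx n).trans (by linarith)
  rw [eLpNorm_exponent_top]
  exact eLpNormEssSup_le_of_ae_bound (ae_restrict_of_ae hae)
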